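/- For $\nu,t\in\mathbb{C}$ with $\operatorname{Re} t>0$ let $$K_\nu(t)=\int_0^\infty e^{-t\cosh x}\cosh(\nu x)\,dx$$ be the modified Bessel function of the second kind (Macdonald function). Then for every integer $m\ge 0$ and every $t\in\mathbb{C}$ with $\operatorname{Re} t>0$, the integrals below converge absolutely and, for each choice of sign (the same on both sides), $$\int_{-\infty}^{\infty} x\,e^{\pm m x-t\cosh x}\,dx=\pm\, m!\sum_{k=0}^{m-1}\frac{K_k(t)}{k!\,(m-k)}\left(\frac{t}{2}\right)^{k-m},$$ where the sum is $0$ when $m=0$. -/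

import Mathlib

/-- The modified Bessel function of the second kind (Macdonald function) `K_ν(t)` on the half-plane
`Re t > 0`, for complex order `ν`:
`K_ν(t) = ∫_0^∞ exp (-t cosh x) cosh (ν x) dx`. -/
noncomputable def besselK (ν t : ℂ) : ℂ :=
  ∫ x in Set.Ioi (0 : ℝ), Complex.exp (-t * Complex.cosh (x : ℂ)) * Complex.cosh (ν * (x : ℂ))

/-- The integral that defines `K_ν(t)` converges absolutely for every order when `Re t > 0`. -/
theorem besselK_integrableOn (ν t : ℂ) (ht : 0 < t.re) :
    MeasureTheory.IntegrableOn (fun x : ℝ =>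
      Complex.exp (-t * Complex.cosh (x : ℂ)) * Complex.cosh (ν * (x : ℂ))) (Set.Ioi (0 : ℝ)) := by
  have hg : MeasureTheory.Integrable (fun x : ℝ =>
      Complex.exp ((-(t.re / 2 : ℝ) : ℂ) * (x : ℂ) ^ 2 + ((‖ν‖ : ℝ) : ℂ) * (x : ℂ) + 0)) :=
    integrable_cexp_quadratic (by simpa using ht) _ _
  refine MeasureTheory.Integrable.mono' (hg.norm.integrableOn) ?_ ?_
  · exact Continuous.aestronglyMeasurable (by fun_prop)
  · refine (MeasureTheory.ae_restrict_iff' measurableSet_Ioi).2 (Filter.Eventually.of_forall fun x hx => ?_)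
    have hx : 0 < x := hx
    have hc : 1 + x ^ 2 / 2 ≤ Real.cosh x := by
      have h := Real.cosh_two_mul (x / 2)
      rw [Real.cosh_sq, mul_div_cancel₀ x (two_ne_zero)] at h
      have hs : x / 2 ≤ Real.sinh (x / 2) := Real.self_le_sinh_iff.2 (by linarith)
      nlinarith
    have h1 : ‖Complex.exp (-t * Complex.cosh (x : ℂ))‖ ≤ Real.exp (-(t.re / 2) * x ^ 2) := by
      rw [Complex.norm_exp, Real.exp_le_exp, ← Complex.ofReal_cosh, Complex.re_mul_ofReal]
      simp only [Complex.neg_re]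
      nlinarith
    have h2 : ‖Complex.cosh (ν * (x : ℂ))‖ ≤ Real.exp (‖ν‖ * x) := by
      have hn : ‖ν * (x : ℂ)‖ = ‖ν‖ * x := by
        rw [norm_mul, Complex.norm_real, Real.norm_of_nonneg hx.le]
      have ha := Complex.norm_exp_le_exp_norm (ν * (x : ℂ))
      have hb := Complex.norm_exp_le_exp_norm (-(ν * (x : ℂ)))
      rw [norm_neg] at hb
      have hs := norm_add_le (Complex.exp (ν * (x : ℂ))) (Complex.exp (-(ν * (x : ℂ))))
      rw [Complex.cosh, norm_div, Complex.norm_ofNat]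
      rw [hn] at ha hb
      linarith
    rw [norm_mul, Complex.norm_exp]
    rw [Complex.norm_exp] at h1
    have hr : ((-(t.re / 2 : ℝ) : ℂ) * (x : ℂ) ^ 2 + ((‖ν‖ : ℝ) : ℂ) * (x : ℂ) + 0).re
        = -(t.re / 2) * x ^ 2 + ‖ν‖ * x := by
      norm_cast
      simp
    rw [Complex.norm_exp, hr, Real.exp_add]
    exact mul_le_mul h1 h2 (norm_nonneg _) (Real.exp_pos _).le

/-! Write I(a) = ∫ e^{ax - t cosh x} dx and J(a) = ∫ x e^{ax - t cosh x} dx over ℝ. The derivative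
of x e^{ax - t cosh x} has integral zero, so I(a) + a J(a) = (t/2)(J(a+1) - J(a-1)). Since I(ν) =
2K_ν, this recurrence determines J(m) from J(0) and J(1), which follow from J being odd. The closed
form obeys the same recurrence (`besselK_sum_recurrence`). With z = t/2 and a_k = K_k z^k / k!, it
is m!/z^m times the convolution of a with 1/n. Formally, A = Σ a_k x^k satisfies ((1-x)A')' = z²A,
so B = -log(1-x) A satisfies ((1-x)B')' = z²B + 2A'; `sum_div_sub_recurrence` is this equation read
off on coefficients. -/

open MeasureTheory Complex in
theorem integrable_cexp_mul_sub_mul_cosh (a t : ℂ) (ht : 0 < t.re) :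
    Integrable (fun x : ℝ => cexp (a * (x : ℂ) - t * Complex.cosh (x : ℂ))) := by
  have hg : Integrable (fun x : ℝ =>
      cexp ((-(t.re / 2 : ℝ) : ℂ) * (x : ℂ) ^ 2 + a * (x : ℂ) + 0)) :=
    integrable_cexp_quadratic (by simpa using ht) _ _
  refine hg.norm.mono' (Continuous.aestronglyMeasurable (by fun_prop))
    (Filter.Eventually.of_forall fun x => ?_)
  -- From cosh x = 1 + 2 sinh²(x/2); it yields a Gaussian majorant.
  have hc : 1 + x ^ 2 / 2 ≤ Real.cosh x := by
    have h := Real.cosh_two_mul (x / 2)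
    rw [Real.cosh_sq, mul_div_cancel₀ x two_ne_zero] at h
    have hs : (x / 2) ^ 2 ≤ Real.sinh (x / 2) ^ 2 := by
      rw [sq_le_sq, Real.abs_sinh]
      exact Real.self_le_sinh_iff.2 (abs_nonneg _)
    nlinarith
  rw [Complex.norm_exp, Complex.norm_exp, Real.exp_le_exp, ← Complex.ofReal_cosh,
    ← Complex.ofReal_pow, ← Complex.ofReal_neg]
  simp only [Complex.sub_re, Complex.add_re, Complex.re_mul_ofReal, Complex.ofReal_re,
    Complex.zero_re]
  nlinarith

-- As |x| ≤ e^x + e^{-x}, the factor x costs only a shift of a by ±1.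
open MeasureTheory Complex in
theorem integrable_mul_cexp_mul_sub_mul_cosh (a t : ℂ) (ht : 0 < t.re) :
    Integrable (fun x : ℝ => (x : ℂ) * cexp (a * (x : ℂ) - t * Complex.cosh (x : ℂ))) := by
  refine ((integrable_cexp_mul_sub_mul_cosh (a + 1) t ht).norm.add
    (integrable_cexp_mul_sub_mul_cosh (a - 1) t ht).norm).mono'
    (Continuous.aestronglyMeasurable (by fun_prop)) (Filter.Eventually.of_forall fun x => ?_)
  have h1 : (a + 1) * (x : ℂ) - t * Complex.cosh x = (x : ℂ) + (a * x - t * Complex.cosh x) := by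
    ring
  have h2 : (a - 1) * (x : ℂ) - t * Complex.cosh x
      = ((-x : ℝ) : ℂ) + (a * x - t * Complex.cosh x) := by
    push_cast; ring
  have hx : |x| ≤ Real.exp x + Real.exp (-x) :=
    abs_le'.2 ⟨by linarith [Real.add_one_le_exp x, Real.exp_pos (-x)],
      by linarith [Real.add_one_le_exp (-x), Real.exp_pos x]⟩
  simp only [Pi.add_apply]
  rw [h1, h2, Complex.exp_add, Complex.exp_add, norm_mul, norm_mul, norm_mul, ← add_mul,
    Complex.norm_real, Real.norm_eq_abs, Complex.norm_exp_ofReal, Complex.norm_exp_ofReal]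
  gcongr

theorem hasDerivAt_cexp_mul_sub_mul_cosh (a t : ℂ) (x : ℝ) :
    HasDerivAt (fun x : ℝ => Complex.exp (a * (x : ℂ) - t * Complex.cosh (x : ℂ)))
      (a * Complex.exp (a * (x : ℂ) - t * Complex.cosh (x : ℂ))
        - t / 2 * (Complex.exp ((a + 1) * (x : ℂ) - t * Complex.cosh (x : ℂ))
          - Complex.exp ((a - 1) * (x : ℂ) - t * Complex.cosh (x : ℂ)))) x := by
  have h := ((((hasDerivAt_id (x : ℂ)).const_mul a).sub
    ((Complex.hasDerivAt_cosh (x : ℂ)).const_mul t)).cexp).comp_ofReal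
  refine h.congr_deriv ?_
  have h1 : (a + 1) * (x : ℂ) - t * Complex.cosh x = (x : ℂ) + (a * x - t * Complex.cosh x) := by
    ring
  have h2 : (a - 1) * (x : ℂ) - t * Complex.cosh x = -(x : ℂ) + (a * x - t * Complex.cosh x) := by
    ring
  rw [h1, h2, Complex.exp_add, Complex.exp_add, Complex.sinh]
  simp only [Pi.sub_apply, id]
  ring

open MeasureTheory Complex in
theorem integral_cexp_mul_sub_mul_cosh_recurrence (a t : ℂ) (ht : 0 < t.re) :
    a * ∫ x : ℝ, cexp (a * (x : ℂ) - t * Complex.cosh (x : ℂ)) =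
      t / 2 * ((∫ x : ℝ, cexp ((a + 1) * (x : ℂ) - t * Complex.cosh (x : ℂ)))
        - ∫ x : ℝ, cexp ((a - 1) * (x : ℂ) - t * Complex.cosh (x : ℂ))) := by
  have hi := fun b : ℂ => integrable_cexp_mul_sub_mul_cosh b t ht
  have hdiff : Integrable (fun x : ℝ => t / 2 * (cexp ((a + 1) * (x : ℂ) - t * Complex.cosh x)
      - cexp ((a - 1) * (x : ℂ) - t * Complex.cosh x))) :=
    ((hi (a + 1)).sub (hi (a - 1))).const_mul (t / 2)
  have h := integral_eq_zero_of_hasDerivAt_of_integrable (hasDerivAt_cexp_mul_sub_mul_cosh a t)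
    (((hi a).const_mul a).sub hdiff) (hi a)
  rw [integral_sub ((hi a).const_mul a) hdiff,
    integral_const_mul, integral_const_mul, integral_sub (hi _) (hi _)] at h
  exact sub_eq_zero.1 h

open MeasureTheory Complex in
theorem integral_mul_cexp_mul_sub_mul_cosh_recurrence (a t : ℂ) (ht : 0 < t.re) :
    (∫ x : ℝ, cexp (a * (x : ℂ) - t * Complex.cosh (x : ℂ)))
      + a * ∫ x : ℝ, (x : ℂ) * cexp (a * (x : ℂ) - t * Complex.cosh (x : ℂ)) =
      t / 2 * ((∫ x : ℝ, (x : ℂ) * cexp ((a + 1) * (x : ℂ) - t * Complex.cosh (x : ℂ)))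
        - ∫ x : ℝ, (x : ℂ) * cexp ((a - 1) * (x : ℂ) - t * Complex.cosh (x : ℂ))) := by
  have hi := integrable_cexp_mul_sub_mul_cosh a t ht
  have hj := fun b : ℂ => integrable_mul_cexp_mul_sub_mul_cosh b t ht
  have hsum : Integrable (fun x : ℝ => cexp (a * (x : ℂ) - t * Complex.cosh x)
      + a * ((x : ℂ) * cexp (a * (x : ℂ) - t * Complex.cosh x))) :=
    hi.add ((hj a).const_mul a)
  have hdiff : Integrable (fun x : ℝ => t / 2 *
      ((x : ℂ) * cexp ((a + 1) * (x : ℂ) - t * Complex.cosh x)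
        - (x : ℂ) * cexp ((a - 1) * (x : ℂ) - t * Complex.cosh x))) :=
    ((hj (a + 1)).sub (hj (a - 1))).const_mul (t / 2)
  have h := integral_eq_zero_of_hasDerivAt_of_integrable
    (fun x : ℝ => (((hasDerivAt_id (x : ℂ)).comp_ofReal).mul
      (hasDerivAt_cexp_mul_sub_mul_cosh a t x)))
    ((hsum.sub hdiff).congr (Filter.Eventually.of_forall fun x => by
      simp only [Pi.sub_apply, id]; ring)) (hj a)
  rw [← sub_eq_zero, ← h, ← integral_const_mul, ← integral_add hi ((hj a).const_mul a),
    ← integral_sub (hj _) (hj _), ← integral_const_mul, ← integral_sub hsum hdiff]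
  congr 1
  funext x
  simp only [id]
  ring

open MeasureTheory Complex in
theorem integral_cexp_mul_sub_mul_cosh_eq_besselK (ν t : ℂ) (ht : 0 < t.re) :
    ∫ x : ℝ, cexp (ν * (x : ℂ) - t * Complex.cosh (x : ℂ)) = 2 * besselK ν t := by
  have hi := integrable_cexp_mul_sub_mul_cosh ν t ht
  have hn : ∫ x in Set.Iic (0 : ℝ), cexp (ν * (x : ℂ) - t * Complex.cosh (x : ℂ))
      = ∫ x in Set.Ioi (0 : ℝ), cexp (ν * ((-x : ℝ) : ℂ) - t * Complex.cosh ((-x : ℝ) : ℂ)) := by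
    have h := integral_comp_neg_Ioi (0 : ℝ)
      (fun x : ℝ => cexp (ν * (x : ℂ) - t * Complex.cosh (x : ℂ)))
    rw [neg_zero] at h
    exact h.symm
  rw [← intervalIntegral.integral_Iic_add_Ioi hi.integrableOn hi.integrableOn (b := 0), hn,
    ← integral_add hi.comp_neg.integrableOn hi.integrableOn, besselK, ← integral_const_mul]
  congr 1
  funext x
  rw [Complex.cosh.eq_1 (ν * x), Complex.ofReal_neg, Complex.cosh_neg, sub_eq_add_neg,
    sub_eq_add_neg, Complex.exp_add, Complex.exp_add, mul_neg, ← neg_mul t]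
  ring

open MeasureTheory Complex in
theorem integral_mul_cexp_neg_mul_sub_mul_cosh (a t : ℂ) :
    ∫ x : ℝ, (x : ℂ) * cexp (-a * (x : ℂ) - t * Complex.cosh (x : ℂ)) =
      -∫ x : ℝ, (x : ℂ) * cexp (a * (x : ℂ) - t * Complex.cosh (x : ℂ)) := by
  rw [← integral_neg_eq_self, ← integral_neg]
  congr 1
  funext x
  rw [Complex.ofReal_neg, Complex.cosh_neg]
  ring_nf

theorem besselK_add_two (n : ℕ) (t : ℂ) (ht : 0 < t.re) :
    t / 2 * besselK ((n + 2 : ℕ) : ℂ) t =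
      t / 2 * besselK (n : ℂ) t + (n + 1) * besselK ((n + 1 : ℕ) : ℂ) t := by
  have h := integral_cexp_mul_sub_mul_cosh_recurrence ((n + 1 : ℕ) : ℂ) t ht
  have h1 : ((n + 1 : ℕ) : ℂ) + 1 = ((n + 2 : ℕ) : ℂ) := by push_cast; ring
  have h2 : ((n + 1 : ℕ) : ℂ) - 1 = n := by push_cast; ring
  simp only [h1, h2, integral_cexp_mul_sub_mul_cosh_eq_besselK _ t ht] at h
  push_cast at h ⊢
  linear_combination -h / 2

/-- A recurrence for the convolution of `1 / n` with a sequence solving a three-term recurrence. -/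
theorem sum_div_sub_recurrence (a : ℕ → ℂ) (z : ℂ)
    (ha : ∀ k : ℕ, ((k : ℂ) + 2) * (k + 1) * a (k + 2) = z ^ 2 * a k + (k + 1) ^ 2 * a (k + 1))
    (m : ℕ) :
    ((m : ℂ) + 2) * (m + 1) * ∑ k ∈ Finset.range (m + 2), a k / ((m : ℂ) + 2 - k) =
      z ^ 2 * ∑ k ∈ Finset.range m, a k / ((m : ℂ) - k) + 2 * (m + 1) * a (m + 1)
        + (m + 1) ^ 2 * ∑ k ∈ Finset.range (m + 1), a k / ((m : ℂ) + 1 - k) := by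
  -- The weight k(k-1) kills the terms k = 0, 1, so the shift by two leaves no boundary terms.
  have h1 : ∑ k ∈ Finset.range (m + 2), (k : ℂ) * (k - 1) * a k / ((m : ℂ) + 2 - k)
      = ∑ k ∈ Finset.range m, ((k : ℂ) + 2) * (k + 1) * a (k + 2) / ((m : ℂ) - k) := by
    rw [Finset.sum_range_succ', Finset.sum_range_succ']
    simp only [Nat.cast_add, Nat.cast_one, Nat.cast_zero, zero_mul, zero_div, add_zero, zero_add,
      sub_self, mul_zero]
    refine Finset.sum_congr rfl fun k _ => ?_
    congr 1 <;> ring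
  have h2 : ∑ k ∈ Finset.range (m + 1), (k : ℂ) ^ 2 * a k / ((m : ℂ) + 1 - k)
      = ∑ k ∈ Finset.range m, ((k : ℂ) + 1) ^ 2 * a (k + 1) / ((m : ℂ) - k) := by
    rw [Finset.sum_range_succ']
    simp only [Nat.cast_add, Nat.cast_one, Nat.cast_zero, zero_mul, zero_div, add_zero, ne_eq,
      OfNat.ofNat_ne_zero, not_false_eq_true, zero_pow]
    refine Finset.sum_congr rfl fun k _ => ?_
    congr 1; ring
  have h3 : z ^ 2 * ∑ k ∈ Finset.range m, a k / ((m : ℂ) - k)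
      = ∑ k ∈ Finset.range (m + 2), (k : ℂ) * (k - 1) * a k / ((m : ℂ) + 2 - k)
        - ∑ k ∈ Finset.range (m + 1), (k : ℂ) ^ 2 * a k / ((m : ℂ) + 1 - k) := by
    rw [h1, h2, ← Finset.sum_sub_distrib, Finset.mul_sum]
    refine Finset.sum_congr rfl fun k _ => ?_
    rw [ha]; ring
  -- Termwise: ((m+2)(m+1) - k(k-1))/(m+2-k) and ((m+1)² - k²)/(m+1-k) both equal m+1+k.
  have h4 : ((m : ℂ) + 2) * (m + 1) * ∑ k ∈ Finset.range (m + 1), a k / ((m : ℂ) + 2 - k)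
      = ∑ k ∈ Finset.range (m + 1), (k : ℂ) * (k - 1) * a k / ((m : ℂ) + 2 - k)
        - ∑ k ∈ Finset.range (m + 1), (k : ℂ) ^ 2 * a k / ((m : ℂ) + 1 - k)
        + (m + 1) ^ 2 * ∑ k ∈ Finset.range (m + 1), a k / ((m : ℂ) + 1 - k) := by
    rw [Finset.mul_sum, Finset.mul_sum, ← Finset.sum_sub_distrib, ← Finset.sum_add_distrib]
    refine Finset.sum_congr rfl fun k hk => ?_
    have hk : k < m + 1 := Finset.mem_range.1 hk
    have hm1 : (m : ℂ) + 1 - k ≠ 0 := by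
      rw [sub_ne_zero]; exact_mod_cast hk.ne'
    have hm2 : (m : ℂ) + 2 - k ≠ 0 := by
      rw [sub_ne_zero]; exact_mod_cast (by omega : m + 2 ≠ k)
    field_simp
    ring
  rw [h3, Finset.sum_range_succ _ (m + 1), mul_add, h4, Finset.sum_range_succ _ (m + 1)]
  have h5 : (m : ℂ) + 2 - ((m + 1 : ℕ) : ℂ) = 1 := by push_cast; ring
  rw [h5]
  push_cast
  ring

theorem besselK_sum_recurrence (m : ℕ) (t : ℂ) (ht : 0 < t.re) (S : ℕ → ℂ)
    (hS : ∀ n, S n = (n.factorial : ℂ) * ∑ k ∈ Finset.range n,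
      besselK (k : ℂ) t / ((k.factorial : ℂ) * ((n : ℂ) - (k : ℂ))) *
        (t / 2) ^ ((k : ℤ) - (n : ℤ))) :
    t / 2 * S (m + 2) = t / 2 * S m + 2 * besselK ((m + 1 : ℕ) : ℂ) t + (m + 1) * S (m + 1) := by
  have hz : t / 2 ≠ 0 := by
    refine div_ne_zero ?_ two_ne_zero
    rintro rfl
    simp at ht
  have hK := fun n => besselK_add_two n t ht
  generalize t / 2 = z at *
  have hf : ∀ n : ℕ, (n.factorial : ℂ) ≠ 0 := fun n => Nat.cast_ne_zero.2 n.factorial_ne_zero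
  have hT : ∀ n, S n = n.factorial / z ^ n * ∑ k ∈ Finset.range n,
      besselK (k : ℂ) t * z ^ k / k.factorial / ((n : ℂ) - k) := by
    intro n
    rw [hS, div_mul_eq_mul_div, mul_div_assoc, Finset.sum_div]
    congr 1
    refine Finset.sum_congr rfl fun k _ => ?_
    rw [zpow_sub₀ hz, zpow_natCast, zpow_natCast]
    simp only [div_eq_mul_inv, mul_inv]
    ring
  have h := sum_div_sub_recurrence (fun k => besselK (k : ℂ) t * z ^ k / k.factorial) z
    (fun k => by
      have h1 := hK k
      have hk := hf k
      have hk1 : (k : ℂ) + 1 ≠ 0 := by exact_mod_cast k.succ_ne_zero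
      have hk2 : (k : ℂ) + 2 ≠ 0 := by exact_mod_cast (k + 1).succ_ne_zero
      simp only [Nat.factorial_succ, Nat.cast_mul]
      push_cast at h1 ⊢
      rw [add_assoc (k : ℂ) 1 1, one_add_one_eq_two]
      field_simp
      linear_combination z * z ^ k * h1) m
  have hm := hf m
  have hm1 : (m : ℂ) + 1 ≠ 0 := by exact_mod_cast m.succ_ne_zero
  rw [hT, hT, hT]
  simp only [Nat.factorial_succ, Nat.cast_mul, pow_succ] at h ⊢
  push_cast at h ⊢
  generalize ∑ k ∈ Finset.range (m + 2), (_ : ℂ) = A at *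
  generalize ∑ k ∈ Finset.range (m + 1), (_ : ℂ) = B at *
  generalize ∑ k ∈ Finset.range m, (_ : ℂ) = C at *
  field_simp at h ⊢
  linear_combination h

open MeasureTheory Complex in
theorem integral_mul_cexp_natCast_mul_sub_mul_cosh (t : ℂ) (ht : 0 < t.re) (m : ℕ) :
    ∫ x : ℝ, (x : ℂ) * cexp ((m : ℂ) * (x : ℂ) - t * Complex.cosh (x : ℂ)) =
      (m.factorial : ℂ) * ∑ k ∈ Finset.range m,
        besselK (k : ℂ) t / ((k.factorial : ℂ) * ((m : ℂ) - (k : ℂ))) *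
          (t / 2) ^ ((k : ℤ) - (m : ℤ)) := by
  have ht0 : t ≠ 0 := by
    rintro rfl
    simp at ht
  induction m using Nat.twoStepInduction with
  | zero =>
    have h := integral_mul_cexp_neg_mul_sub_mul_cosh 0 t
    rw [neg_zero, self_eq_neg] at h
    simpa using h
  | one =>
    -- At a = 0 the term a J(a) drops out and J(-1) = -J(1), leaving 2K_0 = t J(1).
    have h := integral_mul_cexp_mul_sub_mul_cosh_recurrence 0 t ht
    rw [integral_cexp_mul_sub_mul_cosh_eq_besselK _ t ht, zero_add, zero_sub,
      integral_mul_cexp_neg_mul_sub_mul_cosh] at h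
    simp only [Nat.cast_one, Nat.factorial_one, Finset.sum_range_one, Nat.cast_zero,
      Nat.factorial_zero, sub_zero, mul_one, div_one, one_mul, zero_sub, zpow_neg_one, inv_div] at h ⊢
    field_simp at h ⊢
    linear_combination -h / 2
  | more m ih0 ih1 =>
    have h := integral_mul_cexp_mul_sub_mul_cosh_recurrence ((m + 1 : ℕ) : ℂ) t ht
    have h1 : ((m + 1 : ℕ) : ℂ) + 1 = ((m + 2 : ℕ) : ℂ) := by push_cast; ring
    have h2 : ((m + 1 : ℕ) : ℂ) - 1 = m := by push_cast; ring
    simp only [h1, h2] at h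
    rw [integral_cexp_mul_sub_mul_cosh_eq_besselK _ t ht, ih0, ih1] at h
    have hS := besselK_sum_recurrence m t ht _ (fun _ => rfl)
    refine mul_left_cancel₀ (div_ne_zero ht0 two_ne_zero) ?_
    rw [hS]
    rw [Nat.cast_add m 1, Nat.cast_one] at h ⊢
    linear_combination -h

theorem mainTheorem12 (m : ℕ) (t : ℂ) (ht : 0 < t.re) :
    (MeasureTheory.Integrable (fun x : ℝ =>
        (x : ℂ) * Complex.exp ((m : ℂ) * (x : ℂ) - t * Complex.cosh (x : ℂ))) ∧
      ∫ x : ℝ, (x : ℂ) * Complex.exp ((m : ℂ) * (x : ℂ) - t * Complex.cosh (x : ℂ)) =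
        (m.factorial : ℂ) * ∑ k ∈ Finset.range m,
          besselK (k : ℂ) t / ((k.factorial : ℂ) * ((m : ℂ) - (k : ℂ))) *
            (t / 2) ^ ((k : ℤ) - (m : ℤ))) ∧
    (MeasureTheory.Integrable (fun x : ℝ =>
        (x : ℂ) * Complex.exp (-(m : ℂ) * (x : ℂ) - t * Complex.cosh (x : ℂ))) ∧
      ∫ x : ℝ, (x : ℂ) * Complex.exp (-(m : ℂ) * (x : ℂ) - t * Complex.cosh (x : ℂ)) =
        -((m.factorial : ℂ) * ∑ k ∈ Finset.range m,
          besselK (k : ℂ) t / ((k.factorial : ℂ) * ((m : ℂ) - (k : ℂ))) *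
            (t / 2) ^ ((k : ℤ) - (m : ℤ)))) := by
  exact ⟨⟨integrable_mul_cexp_mul_sub_mul_cosh m t ht,
      integral_mul_cexp_natCast_mul_sub_mul_cosh t ht m⟩,
    ⟨integrable_mul_cexp_mul_sub_mul_cosh (-m) t ht,
      (integral_mul_cexp_neg_mul_sub_mul_cosh m t).trans
        (congrArg Neg.neg (integral_mul_cexp_natCast_mul_sub_mul_cosh t ht m))⟩⟩
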